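/- Let $E=(E^0,E^1,r,s)$ be a directed graph with finitely many vertices (and arbitrarily many edges), let $K$ be a field of characteristic $0$, and let $L_K(E)$ be the Leavitt path algebra of $E$ over $K$, i.e. the associative $K$-algebra generated by $E^0\cup E^1\cup\{e^*: e\in E^1\}$ with relations $vv'=\delta_{v,v'}v$ for $v,v'\in E^0$; $s(e)e=er(e)=e$ and $r(e)e^*=e^*s(e)=e^*$ for $e\in E^1$; $e^*f=\delta_{e,f}r(e)$ for $e,f\in E^1$; and $v=\sum_{s(e)=v}ee^*$ for every vertex $v$ that emits at least one and only finitely many edges. Its identity is $\sum_{v\in E^0}v$. Assume that $L_K(E)$ is noncommutative and primitive, i.e. has a faithful simple left module. A sink is a vertex emitting no edges. A cycle is a closed path $c=e_1\cdots e_n$ ($n\ge1$) with $s(e_1),\dots,s(e_n)$ pairwise distinct; it is without exits if $s(e)=s(e_i)$ always implies $e=e_i$. An infinite path ends in $c$ if it and $c^\infty=ccc\cdots$ become equal after removing suitable finite initial segments of each. Call an edge $f$ admissible if $f$ is the initial edge of an infinite path that does not end in a cycle without exits, or $r(f)$ is a sink. Then: 1. $E$ has an admissible edge. 2. If $|E^0|\ge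 2$, then $E$ has an admissible edge $f$ such that $1+2f^*$ and $1+2f$ are invertible and $\langle 1+2f^*,\,1+2f\rangle$ is a non-cyclic free subgroup of $L_K(E)^\times$. 3. For every admissible edge $f$ with $s(f)\neq r(f)$, the elements $1+2f^*$ and $1+2f$ are invertible and $\langle 1+2f^*,\,1+2f\rangle$ is a non-cyclic free subgroup of $L_K(E)^\times$. -/

import Mathlib

/-- A directed graph with vertex set `V` and edge set `E`: every edge has a source and a range.
Multiple edges, loops and vertices emitting infinitely many edges are allowed. -/
structure DirectedGraph (V : Type*) (E : Type*) where
  /-- the source of an edge -/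
  s : E → V
  /-- the range of an edge -/
  r : E → V

namespace DirectedGraph

universe u v w

variable {V : Type u} {E : Type v} (G : DirectedGraph V E)

/-- A sink is a vertex that emits no edges. -/
def IsSink (x : V) : Prop := ∀ e : E, G.s e ≠ x

/-- A regular vertex is neither a sink nor an infinite emitter. -/
def IsRegular (x : V) : Prop := {e : E | G.s e = x}.Nonempty ∧ {e : E | G.s e = x}.Finite

/-- The sequence of edges `μ 0, μ 1, μ 2, …` is an infinite path; its initial edge is `μ 0`. -/
def IsInfinitePath (μ : ℕ → E) : Prop := ∀ k, G.r (μ k) = G.s (μ (k + 1))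

/-- `c 0, …, c (n - 1)` is a cycle of length `n ≥ 1`: consecutive edges match, the last edge ends
where the first one starts (addition in `Fin n` is cyclic), and the sources of the edges are
pairwise distinct. -/
structure IsCycle {n : ℕ} [NeZero n] (c : Fin n → E) : Prop where
  closed : ∀ i, G.r (c i) = G.s (c (i + 1))
  source_injective : Function.Injective fun i => G.s (c i)

/-- The finite path with edges `c 0, …, c (n - 1)` has an exit: an edge `e` with the same source
as some `c i` but different from `c i`. -/
def HasExit {n : ℕ} (c : Fin n → E) : Prop := ∃ (e : E) (i : Fin n), G.s e = G.s (c i) ∧ e ≠ c i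

/-- Two infinite paths are tail-equivalent if they agree after removing suitable initial
segments. -/
def TailEquivalent (μ η : ℕ → E) : Prop := ∃ m n : ℕ, ∀ k, μ (m + k) = η (n + k)

/-- The infinite path `c^∞ = c c c …`. -/
def cyclePower {n : ℕ} [NeZero n] (c : Fin n → E) : ℕ → E := fun k => c (Fin.ofNat n k)

/-- The infinite path `μ` ends in a cycle without exits. -/
def EndsInCycleWithoutExits (μ : ℕ → E) : Prop :=
  ∃ (n : ℕ) (_ : NeZero n) (c : Fin n → E),
    G.IsCycle c ∧ ¬ G.HasExit c ∧ TailEquivalent μ (cyclePower c)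

/-- `f` is the initial edge of an infinite path that does not end in a cycle without exits, or
`f` ends in a sink. -/
def IsAdmissibleEdge (f : E) : Prop :=
  (∃ μ : ℕ → E, G.IsInfinitePath μ ∧ μ 0 = f ∧ ¬ G.EndsInCycleWithoutExits μ) ∨ G.IsSink (G.r f)

/-- The generators of the Leavitt path algebra: vertices, edges and ghost edges. -/
inductive Generator (V : Type u) (E : Type v) : Type (max u v)
  | vertex (x : V)
  | edge (e : E)
  | ghost (e : E)

section Leavitt

variable (K : Type w) [Field K]

/-- The defining relations of the Leavitt path algebra. Since the vertex set is finite, the algebra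
is unital with identity the sum of all vertices; as `FreeAlgebra` is the free unital algebra, the
relation `one` identifies its formal unit with that element. -/
inductive LeavittRel [Fintype V] :
    FreeAlgebra K (Generator V E) → FreeAlgebra K (Generator V E) → Prop
  | one : LeavittRel (∑ x : V, FreeAlgebra.ι K (Generator.vertex x)) 1
  | vertex_self (x : V) :
      LeavittRel (FreeAlgebra.ι K (Generator.vertex x) * FreeAlgebra.ι K (Generator.vertex x))
        (FreeAlgebra.ι K (Generator.vertex x))
  | vertex_ne (x y : V) (h : x ≠ y) :
      LeavittRel (FreeAlgebra.ι K (Generator.vertex x) * FreeAlgebra.ι K (Generator.vertex y)) 0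
  | source_edge (e : E) :
      LeavittRel
        (FreeAlgebra.ι K (Generator.vertex (G.s e)) * FreeAlgebra.ι K (Generator.edge e))
        (FreeAlgebra.ι K (Generator.edge e))
  | edge_range (e : E) :
      LeavittRel
        (FreeAlgebra.ι K (Generator.edge e) * FreeAlgebra.ι K (Generator.vertex (G.r e)))
        (FreeAlgebra.ι K (Generator.edge e))
  | range_ghost (e : E) :
      LeavittRel
        (FreeAlgebra.ι K (Generator.vertex (G.r e)) * FreeAlgebra.ι K (Generator.ghost e))
        (FreeAlgebra.ι K (Generator.ghost e))
  | ghost_source (e : E) :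
      LeavittRel
        (FreeAlgebra.ι K (Generator.ghost e) * FreeAlgebra.ι K (Generator.vertex (G.s e)))
        (FreeAlgebra.ι K (Generator.ghost e))
  | ck1_self (e : E) :
      LeavittRel (FreeAlgebra.ι K (Generator.ghost e) * FreeAlgebra.ι K (Generator.edge e))
        (FreeAlgebra.ι K (Generator.vertex (G.r e)))
  | ck1_ne (e f : E) (h : e ≠ f) :
      LeavittRel (FreeAlgebra.ι K (Generator.ghost e) * FreeAlgebra.ι K (Generator.edge f)) 0
  | ck2 (x : V) (h : G.IsRegular x) :
      LeavittRel (FreeAlgebra.ι K (Generator.vertex x))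
        (∑ e ∈ h.2.toFinset,
          FreeAlgebra.ι K (Generator.edge e) * FreeAlgebra.ι K (Generator.ghost e))

/-- The Leavitt path algebra `L_K(G)` of a graph with finitely many vertices. -/
abbrev LeavittPathAlgebra [Fintype V] : Type (max u v w) := RingQuot (G.LeavittRel K)

variable [Fintype V]

/-- The element of `L_K(G)` given by an edge. -/
noncomputable def edge (f : E) : G.LeavittPathAlgebra K :=
  RingQuot.mkAlgHom K (G.LeavittRel K) (FreeAlgebra.ι K (Generator.edge f))

/-- The element of `L_K(G)` given by a ghost edge. -/
noncomputable def ghost (f : E) : G.LeavittPathAlgebra K :=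
  RingQuot.mkAlgHom K (G.LeavittRel K) (FreeAlgebra.ι K (Generator.ghost f))

/-- `1 + 2f*` and `1 + 2f` are units of `L_K(G)`, and the subgroup of the unit group that they
generate is free and not cyclic. -/
def GeneratesNonCyclicFreeSubgroup (f : E) : Prop :=
  ∃ a b : (G.LeavittPathAlgebra K)ˣ,
    (a : G.LeavittPathAlgebra K) = 1 + 2 * G.ghost K f ∧
    (b : G.LeavittPathAlgebra K) = 1 + 2 * G.edge K f ∧
    IsFreeGroup (Subgroup.closure {a, b}) ∧ ¬ IsCyclic (Subgroup.closure {a, b})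

end Leavitt

end DirectedGraph

/-- A ring is (left) primitive if it has a faithful simple left module. Every simple module is a
quotient of the ring itself, so modules in the universe of the ring suffice. -/
def IsPrimitiveRing.{u} (R : Type u) [Ring R] : Prop :=
  ∃ (M : Type u) (_ : AddCommGroup M) (_ : Module R M),
    IsSimpleModule R M ∧ Module.annihilator R M = ⊥

/-! Let `f` be an edge with distinct ends. Then f² = (f*)² = 0, f*f = r(f) and ff*f = f, so f* and f
act like the two off-diagonal matrix units of 2 × 2 matrices. As soon as r(f) ≠ 0 in the algebra, 1
+ 2f* and 1 + 2f act as Sanov's matrices and ping-pong gives a free group of rank two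
(`isFreeGroup_closure_and_not_isCyclic`). Vertices are shown to be nonzero by letting the algebra
act on a space with a basis of infinite paths, or of finite paths into a fixed sink
(`PathSystem.exists_representation`).

It remains to find edges. Without edges the algebra is commutative, so edges exist. An edge into a
sink is admissible and not a loop. If there is no such edge, every edge starts an infinite path, and
primitivity forbids cycles without exits altogether (`not_isPrimitiveRing_of_isCycle`), so every
edge is admissible. Were all of them loops, the vertices would be nonzero central idempotents, hence
all equal to 1, which is absurd for two orthogonal ones.

A cycle without exits contradicts primitivity because the corner at its vertex v is commutative,
being spanned by cut-down powers of one unit U (`corner_mem_span`). In a primitive ring the nonzero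
elements of such a corner are invertible there (`IsPrimitiveRing.exists_mul_eq_of_commute_corner`).
Yet v - vUⁿv acts on the path c^∞ as the scalar 1 - tⁿ when edges have weight t: it is nonzero by t
= 2 and not invertible by t = 1. -/

namespace DirectedGraph

universe u v w

variable {V : Type u} {E : Type v} (G : DirectedGraph V E)

/-! ### Relations in the Leavitt path algebra. -/

section Relations

variable (K : Type w) [Field K] [Fintype V]

/-- The element of `L_K(G)` given by a vertex. -/
noncomputable def vertex (x : V) : G.LeavittPathAlgebra K :=
  RingQuot.mkAlgHom K (G.LeavittRel K) (FreeAlgebra.ι K (Generator.vertex x))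

theorem vertex_mul_self (x : V) : G.vertex K x * G.vertex K x = G.vertex K x := by
  simpa [vertex] using RingQuot.mkAlgHom_rel K (LeavittRel.vertex_self (G := G) (K := K) x)

theorem vertex_mul_of_ne {x y : V} (h : x ≠ y) : G.vertex K x * G.vertex K y = 0 := by
  simpa [vertex] using RingQuot.mkAlgHom_rel K (LeavittRel.vertex_ne (G := G) (K := K) x y h)

theorem source_mul_edge (e : E) : G.vertex K (G.s e) * G.edge K e = G.edge K e := by
  simpa [vertex, edge] using RingQuot.mkAlgHom_rel K (LeavittRel.source_edge (G := G) (K := K) e)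

theorem edge_mul_range (e : E) : G.edge K e * G.vertex K (G.r e) = G.edge K e := by
  simpa [vertex, edge] using RingQuot.mkAlgHom_rel K (LeavittRel.edge_range (G := G) (K := K) e)

theorem range_mul_ghost (e : E) : G.vertex K (G.r e) * G.ghost K e = G.ghost K e := by
  simpa [vertex, ghost] using RingQuot.mkAlgHom_rel K (LeavittRel.range_ghost (G := G) (K := K) e)

theorem ghost_mul_source (e : E) : G.ghost K e * G.vertex K (G.s e) = G.ghost K e := by
  simpa [vertex, ghost] using RingQuot.mkAlgHom_rel K (LeavittRel.ghost_source (G := G) (K := K) e)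

theorem ghost_mul_edge_self (e : E) : G.ghost K e * G.edge K e = G.vertex K (G.r e) := by
  simpa [vertex, ghost, edge] using
    RingQuot.mkAlgHom_rel K (LeavittRel.ck1_self (G := G) (K := K) e)

theorem ghost_mul_edge_of_ne {e f : E} (h : e ≠ f) : G.ghost K e * G.edge K f = 0 := by
  simpa [ghost, edge] using RingQuot.mkAlgHom_rel K (LeavittRel.ck1_ne (G := G) (K := K) e f h)

theorem vertex_eq_sum (x : V) (h : G.IsRegular x) :
    G.vertex K x = ∑ e ∈ h.2.toFinset, G.edge K e * G.ghost K e := by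
  simpa [vertex, ghost, edge] using
    RingQuot.mkAlgHom_rel K (LeavittRel.ck2 (G := G) (K := K) x h)

variable {K} in
theorem vertex_mul_edge_of_ne {x : V} {e : E} (h : x ≠ G.s e) :
    G.vertex K x * G.edge K e = 0 := by
  rw [← source_mul_edge, ← mul_assoc, vertex_mul_of_ne _ _ h, zero_mul]

variable {K} in
theorem edge_mul_vertex_of_ne {x : V} {e : E} (h : G.r e ≠ x) :
    G.edge K e * G.vertex K x = 0 := by
  rw [← edge_mul_range, mul_assoc, vertex_mul_of_ne _ _ h, mul_zero]

variable {K} in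
theorem vertex_mul_ghost_of_ne {x : V} {e : E} (h : x ≠ G.r e) :
    G.vertex K x * G.ghost K e = 0 := by
  rw [← range_mul_ghost, ← mul_assoc, vertex_mul_of_ne _ _ h, zero_mul]

variable {K} in
theorem ghost_mul_vertex_of_ne {x : V} {e : E} (h : G.s e ≠ x) :
    G.ghost K e * G.vertex K x = 0 := by
  rw [← ghost_mul_source, mul_assoc, vertex_mul_of_ne _ _ h, mul_zero]

variable {K} in
/-- A subalgebra of `L_K(G)` containing vertices, edges and ghost edges is everything. -/
theorem mem_of_generators_mem (S : Subalgebra K (G.LeavittPathAlgebra K))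
    (hv : ∀ x, G.vertex K x ∈ S) (he : ∀ e, G.edge K e ∈ S) (hg : ∀ e, G.ghost K e ∈ S)
    (a : G.LeavittPathAlgebra K) : a ∈ S := by
  obtain ⟨b, rfl⟩ := RingQuot.mkAlgHom_surjective K (G.LeavittRel K) a
  induction b with
  | grade0 r => rw [AlgHom.commutes]; exact S.algebraMap_mem r
  | grade1 x =>
    cases x with
    | vertex x => exact hv x
    | edge e => exact he e
    | ghost e => exact hg e
  | mul a b ha hb => rw [map_mul]; exact S.mul_mem ha hb
  | add a b ha hb => rw [map_add]; exact S.add_mem ha hb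

variable {K} in
/-- An element commuting with vertices, edges and ghost edges is central. -/
theorem commute_of_commute_generators {a : G.LeavittPathAlgebra K}
    (hv : ∀ x, Commute a (G.vertex K x)) (he : ∀ e, Commute a (G.edge K e))
    (hg : ∀ e, Commute a (G.ghost K e)) (b : G.LeavittPathAlgebra K) : Commute a b := by
  have h := G.mem_of_generators_mem (Subalgebra.centralizer K {a})
    (fun x => ?_) (fun e => ?_) (fun e => ?_) b
  · exact (Subalgebra.mem_centralizer_iff K).1 h a rfl
  all_goals
    rw [Subalgebra.mem_centralizer_iff]
    rintro _ rfl
    apply_assumption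

end Relations

/-! ### Representations on spaces of paths and nonvanishing of vertices. -/

/-- A set of (finite or infinite) paths, each of which has a source and at most one initial edge,
such that an edge can be put in front of every path that starts at its range. Paths without initial
edge start at singular vertices. -/
structure PathSystem (X : Type*) where
  /-- the source of a path -/
  src : X → V
  /-- the path obtained by putting an edge in front -/
  cons (e : E) (p : X) (h : src p = G.r e) : X
  /-- the initial edge and the remaining path, if there are any -/
  uncons : X → Option (E × X)
  src_cons (e : E) (p : X) (h : src p = G.r e) : src (cons e p h) = G.s e
  uncons_cons (e : E) (p : X) (h : src p = G.r e) : uncons (cons e p h) = some (e, p)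
  exists_cons (e : E) (p q : X) (h : uncons q = some (e, p)) :
    ∃ h : src p = G.r e, q = cons e p h
  not_isRegular (p : X) (h : uncons p = none) : ¬ G.IsRegular (src p)

namespace PathSystem

variable {G} {X : Type*} (P : G.PathSystem X) (K : Type w) [Field K] (t : K)

open Classical in
/-- The projection onto the span of the paths starting at `x`. -/
noncomputable def vertexOp (x : V) : Module.End K (X →₀ K) :=
  Finsupp.linearCombination K fun p => if P.src p = x then Finsupp.single p 1 else 0

open Classical in
/-- The operator putting the edge `e` in front of a path, scaled by `t`. -/
noncomputable def edgeOp (e : E) : Module.End K (X →₀ K) :=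
  Finsupp.linearCombination K fun p =>
    if h : P.src p = G.r e then Finsupp.single (P.cons e p h) t else 0

open Classical in
/-- The operator removing the initial edge `e` from a path, scaled by `t⁻¹`. -/
noncomputable def ghostOp (e : E) : Module.End K (X →₀ K) :=
  Finsupp.linearCombination K fun p =>
    match P.uncons p with
    | some (f, q) => if f = e then Finsupp.single q t⁻¹ else 0
    | none => 0

variable {K}

open Classical in
theorem vertexOp_single (x : V) (p : X) (a : K) :
    P.vertexOp K x (Finsupp.single p a) = if P.src p = x then Finsupp.single p a else 0 := by
  simp [vertexOp]

variable {t}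

theorem edgeOp_single {e : E} {p : X} (h : P.src p = G.r e) (a : K) :
    P.edgeOp K t e (Finsupp.single p a) = Finsupp.single (P.cons e p h) (a * t) := by
  simp [edgeOp, h]

theorem edgeOp_single_of_ne {e : E} {p : X} (h : P.src p ≠ G.r e) (a : K) :
    P.edgeOp K t e (Finsupp.single p a) = 0 := by
  simp [edgeOp, h]

theorem ghostOp_single_cons {e : E} {p : X} (h : P.src p = G.r e) (a : K) :
    P.ghostOp K t e (Finsupp.single (P.cons e p h) a) = Finsupp.single p (a * t⁻¹) := by
  simp [ghostOp, P.uncons_cons]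

theorem ghostOp_single_cons_of_ne {e f : E} (hf : f ≠ e) {p : X} (h : P.src p = G.r f) (a : K) :
    P.ghostOp K t e (Finsupp.single (P.cons f p h) a) = 0 := by
  simp [ghostOp, P.uncons_cons, hf]

theorem ghostOp_single_of_uncons_eq_none {e : E} {p : X} (h : P.uncons p = none) (a : K) :
    P.ghostOp K t e (Finsupp.single p a) = 0 := by
  simp [ghostOp, h]

theorem uncons_eq_none_or_eq_cons (q : X) :
    P.uncons q = none ∨ ∃ (e : E) (p : X) (h : P.src p = G.r e), q = P.cons e p h := by
  rcases hq : P.uncons q with _ | ⟨e, p⟩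
  · exact .inl rfl
  · exact .inr ⟨e, p, P.exists_cons e p q hq⟩

variable (t) [Fintype V]

/-- The action of `L_K(G)` on the vector space with basis a path system, with weight `t`. -/
theorem exists_representation (ht : t ≠ 0) :
    ∃ ρ : G.LeavittPathAlgebra K →ₐ[K] Module.End K (X →₀ K),
      (∀ x, ρ (G.vertex K x) = P.vertexOp K x) ∧ (∀ e, ρ (G.edge K e) = P.edgeOp K t e) ∧
      ∀ e, ρ (G.ghost K e) = P.ghostOp K t e := by
  classical
  let φ : FreeAlgebra K (Generator V E) →ₐ[K] Module.End K (X →₀ K) :=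
    FreeAlgebra.lift K fun g => match g with
      | .vertex x => P.vertexOp K x
      | .edge e => P.edgeOp K t e
      | .ghost e => P.ghostOp K t e
  -- All relations are homogeneous for the grading with edges in degree 1 and ghost edges in degree
  -- -1, so the weights t and t⁻¹ cancel.
  have hφ : ∀ ⦃a b⦄, G.LeavittRel K a b → φ a = φ b := by
    intro a b hab
    refine Finsupp.lhom_ext fun q c => ?_
    induction hab with
    | one =>
      simp [-Finsupp.single_mul, φ, vertexOp_single]
    | vertex_self x =>
      by_cases h : P.src q = x <;> simp [-Finsupp.single_mul, φ, vertexOp_single, h]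
    | vertex_ne x y hxy =>
      by_cases h : P.src q = y <;> simp [-Finsupp.single_mul, φ, vertexOp_single, h, hxy.symm]
    | source_edge e =>
      by_cases h : P.src q = G.r e <;>
        simp [-Finsupp.single_mul, φ, vertexOp_single, h, edgeOp_single, edgeOp_single_of_ne, P.src_cons]
    | edge_range e =>
      by_cases h : P.src q = G.r e <;>
        simp [-Finsupp.single_mul, φ, vertexOp_single, h, edgeOp_single, edgeOp_single_of_ne]
    | range_ghost e =>
      rcases P.uncons_eq_none_or_eq_cons q with h | ⟨f, p, h, rfl⟩
      · simp [-Finsupp.single_mul, φ, ghostOp_single_of_uncons_eq_none, h]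
      · by_cases hf : f = e
        · subst hf
          simp [-Finsupp.single_mul, φ, ghostOp_single_cons, vertexOp_single, h]
        · simp [-Finsupp.single_mul, φ, ghostOp_single_cons_of_ne, hf]
    | ghost_source e =>
      rcases P.uncons_eq_none_or_eq_cons q with h | ⟨f, p, h, rfl⟩
      · by_cases hs : P.src q = G.s e <;>
          simp [-Finsupp.single_mul, φ, ghostOp_single_of_uncons_eq_none, h, vertexOp_single, hs]
      · by_cases hf : f = e
        · subst hf
          simp [-Finsupp.single_mul, φ, ghostOp_single_cons, vertexOp_single, P.src_cons]
        · by_cases hs : G.s f = G.s e <;>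
            simp [-Finsupp.single_mul, φ, ghostOp_single_cons_of_ne, hf, vertexOp_single, P.src_cons, hs]
    | ck1_self e =>
      by_cases h : P.src q = G.r e <;>
        simp [-Finsupp.single_mul, φ, vertexOp_single, h, edgeOp_single, edgeOp_single_of_ne, ghostOp_single_cons, ht]
    | ck1_ne e f hef =>
      by_cases h : P.src q = G.r f <;>
        simp [-Finsupp.single_mul, φ, h, edgeOp_single, edgeOp_single_of_ne, ghostOp_single_cons_of_ne, hef.symm]
    | ck2 x hx =>
      rcases P.uncons_eq_none_or_eq_cons q with h | ⟨f, p, h, rfl⟩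
      · have hq : P.src q ≠ x := fun hq => P.not_isRegular q h (hq ▸ hx)
        simp [-Finsupp.single_mul, φ, ghostOp_single_of_uncons_eq_none, h, vertexOp_single, hq]
      -- The operator of ee* fixes the paths with initial edge e and kills the others, so only the
      -- summand of the actual initial edge survives.
      · have key : ∀ e, P.edgeOp K t e (P.ghostOp K t e (Finsupp.single (P.cons f p h) c)) =
            if f = e then Finsupp.single (P.cons f p h) c else 0 := by
          intro e
          by_cases hf : f = e
          · subst hf
            simp [-Finsupp.single_mul, ghostOp_single_cons, edgeOp_single, h, ht]
          · simp [ghostOp_single_cons_of_ne, hf]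
        simp [-Finsupp.single_mul, φ, vertexOp_single, P.src_cons, key]
  refine ⟨RingQuot.liftAlgHom K ⟨φ, hφ⟩, fun x => ?_, fun e => ?_, fun e => ?_⟩ <;>
    simp [vertex, edge, ghost, φ]

/-- The vertex fixes the basis vector of `p`. -/
theorem vertex_ne_zero (p : X) : G.vertex K (P.src p) ≠ 0 := by
  obtain ⟨ρ, hρ, -⟩ := P.exists_representation (1 : K) one_ne_zero
  intro h
  have := congrArg (fun a => ρ a (Finsupp.single p 1)) h
  simp [hρ, vertexOp_single] at this

end PathSystem

/-- The path system of all infinite paths. -/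
noncomputable def infinitePaths : G.PathSystem {μ : ℕ → E // G.IsInfinitePath μ} where
  src μ := G.s (μ.1 0)
  cons e μ h := ⟨fun k => Nat.casesOn k e μ.1, fun k => by
    cases k with
    | zero => exact h.symm
    | succ k => exact μ.2 k⟩
  uncons μ := some (μ.1 0, ⟨fun k => μ.1 (k + 1), fun k => μ.2 (k + 1)⟩)
  src_cons _ _ _ := rfl
  uncons_cons _ _ _ := rfl
  exists_cons := by
    rintro e p q h
    simp only [Option.some.injEq, Prod.mk.injEq] at h
    obtain ⟨rfl, rfl⟩ := h
    refine ⟨(q.2 0).symm, Subtype.ext (funext fun k => ?_)⟩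
    cases k <;> rfl
  not_isRegular := by simp

/-- The source of a finite path with range `x`. -/
def sourceOf (x : V) : List E → V
  | [] => x
  | e :: _ => G.s e

/-- The list of edges `l` is a finite path with range `x`. -/
def IsPathTo (x : V) : List E → Prop
  | [] => True
  | e :: l => G.sourceOf x l = G.r e ∧ IsPathTo x l

/-- The path system of all finite paths ending in a given sink. -/
noncomputable def pathsToSink {x : V} (hx : G.IsSink x) :
    G.PathSystem {l : List E // G.IsPathTo x l} where
  src l := G.sourceOf x l.1
  cons e l h := ⟨e :: l.1, h, l.2⟩
  uncons
    | ⟨[], _⟩ => none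
    | ⟨e :: l, h⟩ => some (e, ⟨l, h.2⟩)
  src_cons _ _ _ := rfl
  uncons_cons _ _ _ := rfl
  exists_cons := by
    rintro e p ⟨_ | ⟨f, l⟩, hl⟩ h
    · simp at h
    · simp only [Option.some.injEq, Prod.mk.injEq] at h
      obtain ⟨rfl, rfl⟩ := h
      exact ⟨hl.1, rfl⟩
  not_isRegular := by
    rintro ⟨_ | ⟨f, l⟩, hl⟩ h ⟨⟨e, he⟩, -⟩
    · exact hx e he
    · simp at h

variable (K : Type w) [Field K] [Fintype V]

theorem vertex_ne_zero_of_isSink {x : V} (hx : G.IsSink x) : G.vertex K x ≠ 0 :=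
  (G.pathsToSink hx).vertex_ne_zero ⟨[], trivial⟩

theorem source_ne_zero_of_isInfinitePath {μ : ℕ → E} (hμ : G.IsInfinitePath μ) :
    G.vertex K (G.s (μ 0)) ≠ 0 :=
  G.infinitePaths.vertex_ne_zero ⟨μ, hμ⟩

theorem IsAdmissibleEdge.range_ne_zero {f : E} (hf : G.IsAdmissibleEdge f) :
    G.vertex K (G.r f) ≠ 0 := by
  obtain ⟨μ, hμ, rfl, -⟩ | hf := hf
  · rw [hμ 0]
    exact G.source_ne_zero_of_isInfinitePath K (μ := fun k => μ (k + 1)) fun k => hμ (k + 1)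
  · exact G.vertex_ne_zero_of_isSink K hf

end DirectedGraph

/-! ### Sanov's ping-pong argument for two elements of square zero. -/

section PingPong

variable {A : Type*} [Ring A]

/-- The one-parameter group `k ↦ 1 + 2 k e` attached to an element `e` with square zero. -/
def unipotentHom (e : A) (he : e * e = 0) : Multiplicative ℤ →* Aˣ :=
  MonoidHom.toHomUnits
    { toFun := fun k => 1 + (2 * k.toAdd) • e
      map_one' := by simp
      map_mul' := fun k l => by
        simp only [toAdd_mul, mul_add, add_mul, one_mul, mul_one, smul_mul_smul_comm, he, smul_zero,
          add_smul, add_zero]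
        abel }

theorem unipotentHom_apply (e : A) (he : e * e = 0) (k : Multiplicative ℤ) :
    (unipotentHom e he k : A) = 1 + (2 * k.toAdd) • e := rfl

theorem range_unipotentHom (e : A) (he : e * e = 0) :
    (unipotentHom e he).range = Subgroup.zpowers (unipotentHom e he (.ofAdd 1)) := by
  ext x
  simp only [MonoidHom.mem_range, Subgroup.mem_zpowers_iff, ← map_zpow, ← ofAdd_zsmul,
    smul_eq_mul, mul_one]
  exact ⟨fun ⟨k, hk⟩ => ⟨k.toAdd, hk⟩, fun ⟨k, hk⟩ => ⟨.ofAdd k, hk⟩⟩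

theorem abs_lt_abs_add_two_mul {p q k : ℤ} (h : |p| < |q|) (hk : k ≠ 0) :
    |q| < |p + 2 * k * q| := by
  have h1 : |2 * k * q| ≤ |p + 2 * k * q| + |p| := by
    have := abs_sub (p + 2 * k * q) p
    rwa [add_sub_cancel_left] at this
  have h2 : 2 * |q| ≤ |2 * k * q| := by
    rw [abs_mul, abs_mul, abs_two]
    have : 1 ≤ |k| := Int.one_le_abs hk
    nlinarith [abs_nonneg q]
  linarith

/-- Two elements `e`, `f` with `e² = f² = 0` and `f e f = f` span, together with `e f` and `f e`,
a quotient of the algebra of `2 × 2` matrices; `1 + 2 e` and `1 + 2 f` then generate a free group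
of rank two by Sanov's argument. -/
theorem isFreeGroup_closure_and_not_isCyclic {e f : A} (he : e * e = 0) (hf : f * f = 0)
    (hfef : f * e * f = f) (htf : ∀ p : ℤ, p • (e * f) = 0 → p = 0) :
    IsFreeGroup (Subgroup.closure {unipotentHom e he (.ofAdd 1), unipotentHom f hf (.ofAdd 1)}) ∧
      ¬ IsCyclic
        (Subgroup.closure {unipotentHom e he (.ofAdd 1), unipotentHom f hf (.ofAdd 1)}) := by
  -- `vec p q` is the column vector (p, q): left multiplication by `e` sends it to (q, 0) and by `f`
  -- to (0, p).
  let vec : ℤ → ℤ → A := fun p q => p • (e * f) + q • f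
  have hef : ∀ p q, e * vec p q = vec q 0 := fun p q => by
    simp [-zsmul_eq_mul, vec, mul_add, ← mul_assoc, he]
  have hff : ∀ p q, f * vec p q = vec 0 p := fun p q => by
    simp [-zsmul_eq_mul, vec, mul_add, ← mul_assoc, hf, hfef]
  have hinj : ∀ {p q p' q'}, vec p q = vec p' q' → p = p' ∧ q = q' := by
    have snd : ∀ {p q p' q'}, vec p q = vec p' q' → q = q' := by
      intro p q p' q' h
      have := congrArg (e * ·) h
      simp only [hef] at this
      refine sub_eq_zero.1 (htf _ ?_)
      simpa [vec, sub_smul, sub_eq_zero] using this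
    intro p q p' q' h
    refine ⟨snd (p := 0) (p' := 0) ?_, snd h⟩
    rw [← hff p q, h, hff]
  have vec_add : ∀ p q p' q' (k : ℤ), vec p q + k • vec p' q' = vec (p + k * p') (q + k * q') := by
    intro p q p' q' k
    simp only [vec, add_smul, smul_add, mul_smul]
    abel
  let φ : Bool → (Multiplicative ℤ →* Aˣ) := fun i =>
    cond i (unipotentHom e he) (unipotentHom f hf)
  -- Nontrivial powers of 1 + 2e map the vectors with |p| < |q| to those with |q| < |p|, and powers
  -- of 1 + 2f do the reverse.
  let S : Bool → Set A := fun i => {v | ∃ p q : ℤ, cond i (|q| < |p|) (|p| < |q|) ∧ v = vec p q}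
  have hφ : Function.Injective (Monoid.CoprodI.lift φ) := by
    refine Monoid.CoprodI.lift_injective_of_ping_pong φ ?_ S ?_ ?_ ?_
    -- With only two factors, the ping-pong lemma needs a factor with at least three elements; here
    -- both are infinite.
    · right
      exact ⟨true, by simp⟩
    · rintro (_ | _)
      · exact ⟨vec 0 1, 0, 1, by simp, rfl⟩
      · exact ⟨vec 1 0, 1, 0, by simp, rfl⟩
    · have key : Disjoint (S true) (S false) := by
        rw [Set.disjoint_left]
        rintro _ ⟨p, q, h, rfl⟩ ⟨p', q', h', heq⟩
        obtain ⟨rfl, rfl⟩ := hinj heq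
        exact lt_asymm h h'
      rintro (_ | _) (_ | _) hij
      · exact absurd rfl hij
      · exact key.symm
      · exact key
      · exact absurd rfl hij
    · rintro (_ | _) (_ | _) hij k hk
      · exact absurd rfl hij
      · rintro _ ⟨_, ⟨p, q, h, rfl⟩, rfl⟩
        refine ⟨p, q + 2 * k.toAdd * p, abs_lt_abs_add_two_mul h hk, ?_⟩
        change (unipotentHom f hf k : A) * vec p q = _
        rw [unipotentHom_apply, add_mul, one_mul, smul_mul_assoc, hff, vec_add, mul_zero, add_zero]
      · rintro _ ⟨_, ⟨p, q, h, rfl⟩, rfl⟩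
        refine ⟨p + 2 * k.toAdd * q, q, abs_lt_abs_add_two_mul h hk, ?_⟩
        change (unipotentHom e he k : A) * vec p q = _
        rw [unipotentHom_apply, add_mul, one_mul, smul_mul_assoc, hef, vec_add, mul_zero, add_zero]
      · exact absurd rfl hij
  have hrange : (Monoid.CoprodI.lift φ).range =
      Subgroup.closure {unipotentHom e he (.ofAdd 1), unipotentHom f hf (.ofAdd 1)} := by
    rw [Monoid.CoprodI.range_eq_iSup, iSup_bool_eq]
    simp only [φ, cond_true, cond_false, range_unipotentHom]
    rw [Set.insert_eq, Subgroup.closure_union, Subgroup.zpowers_eq_closure,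
      Subgroup.zpowers_eq_closure]
  constructor
  · rw [← hrange]
    have : IsFreeGroup (Multiplicative ℤ) := .ofMulEquiv (FreeGroup.mulEquivIntOfUnique (α := Unit))
    exact .ofMulEquiv (MonoidHom.ofInjective hφ)
  · intro hcyc
    have hcomm : unipotentHom e he (.ofAdd 1) * unipotentHom f hf (.ofAdd 1) =
        unipotentHom f hf (.ofAdd 1) * unipotentHom e he (.ofAdd 1) := by
      let H := Subgroup.closure {unipotentHom e he (.ofAdd 1), unipotentHom f hf (.ofAdd 1)}
      exact congrArg Subtype.val (IsCyclic.isMulCommutative.is_comm.comm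
        (⟨_, Subgroup.subset_closure (.inl rfl)⟩ : H) ⟨_, Subgroup.subset_closure (.inr rfl)⟩)
    -- The two products send (1, 0) to (5, 2) and (1, 2).
    have := congrArg (fun u : Aˣ => (u : A) * vec 1 0) hcomm
    simp only [Units.val_mul, unipotentHom_apply, mul_assoc, add_mul, one_mul, smul_mul_assoc, hef,
      hff, vec_add, toAdd_ofAdd] at this
    simpa using (hinj this).1

end PingPong

/-! ### Free subgroups from edges that are not loops. -/

namespace DirectedGraph

universe u v w

variable {V : Type u} {E : Type v} (G : DirectedGraph V E) (K : Type w) [Field K] [Fintype V]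

theorem generatesNonCyclicFreeSubgroup_of_source_ne_range [CharZero K] {f : E}
    (hf : G.s f ≠ G.r f) (h0 : G.vertex K (G.r f) ≠ 0) :
    G.GeneratesNonCyclicFreeSubgroup K f := by
  have he : G.ghost K f * G.ghost K f = 0 := by
    nth_rw 2 [← range_mul_ghost]
    rw [← mul_assoc, G.ghost_mul_vertex_of_ne hf, zero_mul]
  have hff : G.edge K f * G.edge K f = 0 := by
    nth_rw 2 [← source_mul_edge]
    rw [← mul_assoc, G.edge_mul_vertex_of_ne hf.symm, zero_mul]
  obtain ⟨h1, h2⟩ := isFreeGroup_closure_and_not_isCyclic he hff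
    (by rw [mul_assoc, ghost_mul_edge_self, edge_mul_range]) (fun p hp => by
      rw [ghost_mul_edge_self, ← Int.cast_smul_eq_zsmul K] at hp
      simpa [h0] using hp)
  refine ⟨_, _, ?_, ?_, h1, h2⟩ <;> simp [unipotentHom_apply, two_mul]

end DirectedGraph

/-! ### Commutative corners of primitive rings. -/

/-- In a primitive ring, every nonzero element of a commutative corner `v R v` is invertible
there. -/
theorem IsPrimitiveRing.exists_mul_eq_of_commute_corner {R : Type*} [Ring R]
    (hR : IsPrimitiveRing R) {v : R} (hv : v * v = v)
    (hcomm : ∀ a b, Commute (v * a * v) (v * b * v)) {z : R} (hz : v * z * v = z) (hz0 : z ≠ 0) :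
    ∃ b, b * z = v := by
  obtain ⟨M, _, _, _, hann⟩ := hR
  have faithful : ∀ r : R, (∀ m : M, r • m = 0) → r = 0 := fun r hr => by
    rw [← Submodule.mem_bot (R := R), ← hann]
    exact Module.mem_annihilator.2 hr
  have hzv : z * v = z := by rw [← hz, mul_assoc, hv]
  have hvz : v * z = z := by rw [← hz, ← mul_assoc, ← mul_assoc, hv]
  obtain ⟨m, hm⟩ : ∃ m : M, z • m ≠ 0 := by
    by_contra! h
    exact hz0 (faithful z h)
  set y := v • m with hy
  have hvy : v • y = y := by rw [hy, ← mul_smul, hv]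
  have hzy : z • y ≠ 0 := by rwa [hy, ← mul_smul, hzv]
  have hy0 : y ≠ 0 := fun h => hzy (by rw [h, smul_zero])
  obtain ⟨b, hb⟩ := IsSimpleModule.toSpanSingleton_surjective R hzy y
  simp only [LinearMap.toSpanSingleton_apply] at hb
  -- The corner carries `y` onto all of vM. Since vbzv fixes `y` and commutes with the corner, it is
  -- the identity on vM, and faithfulness turns this into an equation in the ring.
  have hbz : (v * (b * z) * v) • y = y := by
    rw [mul_assoc, mul_assoc, hzv, mul_smul, mul_smul, hb, hvy]
  refine ⟨v * b, ?_⟩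
  rw [← sub_eq_zero]
  refine faithful _ fun x => ?_
  obtain ⟨t, ht⟩ := IsSimpleModule.toSpanSingleton_surjective R hy0 (v • x)
  simp only [LinearMap.toSpanSingleton_apply] at ht
  have hty : (v * t * v) • y = v • x := by
    rw [mul_smul, hvy, mul_smul, ht, ← mul_smul, hv]
  have : (v * (b * z) * v) • v • x = v • x := by
    rw [← hty, ← mul_smul, (hcomm _ _).eq, mul_smul, hbz]
  rw [sub_smul, sub_eq_zero, ← this, ← mul_smul, mul_assoc _ v v, hv]
  rw [mul_assoc _ _ v, mul_assoc b, hzv, mul_assoc]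

/-! ### Cycles without exits as abstract families. -/

/-- Elements `v i`, `e i`, `g i` of a ring that behave like the vertices, edges and ghost edges of
a cycle without exits. -/
structure CycleFamily {A : Type*} [Ring A] {n : ℕ} [NeZero n] (v e g : Fin n → A) : Prop where
  idem (i) : v i * v i = v i
  orth (i j) (h : i ≠ j) : v i * v j = 0
  source_edge (i) : v i * e i = e i
  edge_range (i) : e i * v (i + 1) = e i
  range_ghost (i) : v (i + 1) * g i = g i
  ghost_source (i) : g i * v i = g i
  edge_ghost (i) : e i * g i = v i
  ghost_edge (i) : g i * e i = v (i + 1)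

namespace CycleFamily

variable {A : Type*} [Ring A] {n : ℕ} [NeZero n] {v e g : Fin n → A} (h : CycleFamily v e g)

include h

theorem vertex_mul_edge_of_ne {i j : Fin n} (hij : i ≠ j) : v i * e j = 0 := by
  rw [← h.source_edge, ← mul_assoc, h.orth _ _ hij, zero_mul]

theorem edge_mul_vertex_of_ne {i j : Fin n} (hij : i + 1 ≠ j) : e i * v j = 0 := by
  rw [← h.edge_range, mul_assoc, h.orth _ _ hij, mul_zero]

theorem vertex_mul_ghost_of_ne {i j : Fin n} (hij : i ≠ j + 1) : v i * g j = 0 := by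
  rw [← h.range_ghost, ← mul_assoc, h.orth _ _ hij, zero_mul]

theorem ghost_mul_vertex_of_ne {i j : Fin n} (hij : i ≠ j) : g i * v j = 0 := by
  rw [← h.ghost_source, mul_assoc, h.orth _ _ hij, mul_zero]

/-- The unit rotates the cycle and is the identity off it: U = ∑ e + (1 - ∑ v), with inverse ∑ g +
(1 - ∑ v). It turns all edges and ghost edges of the cycle into pieces of U and U⁻¹. -/
theorem exists_unit : ∃ U : Aˣ, (∀ i, v i * U = e i) ∧ (∀ i, U * v (i + 1) = e i) ∧
    ∀ i, ↑U⁻¹ * v i = g i := by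
  have sum_mul_v (i) : (∑ j, v j) * v i = v i := by
    rw [Finset.sum_mul, Finset.sum_eq_single i (fun j _ hj => h.orth j i hj) (by simp), h.idem]
  have v_mul_sum (i) : v i * ∑ j, v j = v i := by
    rw [Finset.mul_sum, Finset.sum_eq_single i (fun j _ hj => h.orth i j hj.symm) (by simp), h.idem]
  have v_e (i) : v i * ∑ j, e j = e i := by
    rw [Finset.mul_sum, Finset.sum_eq_single i
      (fun j _ hj => h.vertex_mul_edge_of_ne hj.symm) (by simp), h.source_edge]
  have v_g (i) : v (i + 1) * ∑ j, g j = g i := by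
    rw [Finset.mul_sum, Finset.sum_eq_single i
      (fun j _ hj => h.vertex_mul_ghost_of_ne fun h' => hj (add_right_cancel h').symm) (by simp),
      h.range_ghost]
  have e_v (i) : (∑ j, e j) * v (i + 1) = e i := by
    rw [Finset.sum_mul, Finset.sum_eq_single i
      (fun j _ hj => h.edge_mul_vertex_of_ne fun h' => hj (add_right_cancel h')) (by simp),
      h.edge_range]
  have g_v (i) : (∑ j, g j) * v i = g i := by
    rw [Finset.sum_mul, Finset.sum_eq_single i
      (fun j _ hj => h.ghost_mul_vertex_of_ne hj) (by simp), h.ghost_source]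
  have shift (F : Fin n → A) : ∑ i, F (i + 1) = ∑ i, F i :=
    Equiv.sum_comp (Equiv.addRight (1 : Fin n)) F
  have v_U (i) : v i * (∑ j, e j + (1 - ∑ j, v j)) = e i := by
    rw [mul_add, v_e, mul_sub, mul_one, v_mul_sum, sub_self, add_zero]
  have v_U' (i) : v (i + 1) * (∑ j, g j + (1 - ∑ j, v j)) = g i := by
    rw [mul_add, v_g, mul_sub, mul_one, v_mul_sum, sub_self, add_zero]
  have U_v (i) : (∑ j, e j + (1 - ∑ j, v j)) * v (i + 1) = e i := by
    rw [add_mul, e_v, sub_mul, one_mul, sum_mul_v, sub_self, add_zero]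
  have U'_v (i) : (∑ j, g j + (1 - ∑ j, v j)) * v i = g i := by
    rw [add_mul, g_v, sub_mul, one_mul, sum_mul_v, sub_self, add_zero]
  set U := ∑ j, e j + (1 - ∑ j, v j) with hU
  set U' := ∑ j, g j + (1 - ∑ j, v j) with hU'
  have P_e : (∑ j, v j) * U = ∑ j, e j := by
    rw [Finset.sum_mul]; exact Finset.sum_congr rfl fun i _ => v_U i
  have P_g : (∑ j, v j) * U' = ∑ j, g j := by
    rw [← shift v, Finset.sum_mul]; exact Finset.sum_congr rfl fun i _ => v_U' i
  have hUU' : U * U' = 1 := by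
    have h1 : (∑ j, v j) * (U * U') = ∑ j, v j := by
      rw [Finset.sum_mul]
      refine Finset.sum_congr rfl fun i _ => ?_
      rw [← mul_assoc, v_U, ← h.edge_range, mul_assoc, v_U', h.edge_ghost]
    have h2 : (1 - ∑ j, v j) * U = 1 - ∑ j, v j := by
      rw [sub_mul, one_mul, P_e, hU]; abel
    have h3 : (1 - ∑ j, v j) * U' = 1 - ∑ j, v j := by
      rw [sub_mul, one_mul, P_g, hU']; abel
    calc U * U' = (∑ j, v j) * (U * U') + (1 - ∑ j, v j) * U * U' := by noncomm_ring
      _ = 1 := by rw [h1, h2, h3]; abel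
  have hU'U : U' * U = 1 := by
    have h1 : (∑ j, v j) * (U' * U) = ∑ j, v j := by
      rw [← shift v, Finset.sum_mul]
      refine Finset.sum_congr rfl fun i _ => ?_
      rw [← mul_assoc, v_U', ← h.ghost_source, mul_assoc, v_U, h.ghost_edge]
    have h2 : (1 - ∑ j, v j) * U' = 1 - ∑ j, v j := by
      rw [sub_mul, one_mul, P_g, hU']; abel
    have h3 : (1 - ∑ j, v j) * U = 1 - ∑ j, v j := by
      rw [sub_mul, one_mul, P_e, hU]; abel
    calc U' * U = (∑ j, v j) * (U' * U) + (1 - ∑ j, v j) * U' * U := by noncomm_ring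
      _ = 1 := by rw [h1, h2, h3]; abel
  exact ⟨⟨U, U', hUU', hU'U⟩, v_U, U_v, U'_v⟩

-- Conjugation by U permutes the idempotents cyclically; which index occurs does not matter later.
omit h in
theorem exists_zpow_mul {U : Aˣ} (hU : ∀ i, v i * U = U * v (i + 1)) (k : ℤ) (j : Fin n) :
    ∃ i, (↑(U ^ k) : A) * v j = v i * ↑(U ^ k) := by
  induction k generalizing j with
  | zero => exact ⟨j, by simp⟩
  | succ k ih =>
    obtain ⟨i, hi⟩ := ih (j - 1)
    refine ⟨i, ?_⟩
    rw [zpow_add_one, Units.val_mul, mul_assoc, ← mul_assoc (v i), ← hi, mul_assoc, hU,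
      sub_add_cancel]
  | pred k ih =>
    obtain ⟨i, hi⟩ := ih (j + 1)
    refine ⟨i, ?_⟩
    have : (↑U⁻¹ : A) * v j = v (j + 1) * ↑U⁻¹ := by
      rw [Units.inv_mul_eq_iff_eq_mul, ← mul_assoc, ← hU, mul_assoc, Units.mul_inv, mul_one]
    rw [zpow_sub_one, Units.val_mul, mul_assoc, this, ← mul_assoc, hi, mul_assoc]

end CycleFamily

/-! ### Cycles without exits rule out primitivity. -/

namespace DirectedGraph

universe u v w

variable {V : Type u} {E : Type v} (G : DirectedGraph V E) {n : ℕ} [NeZero n] {c : Fin n → E}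

theorem IsCycle.isInfinitePath_cyclePower {G : DirectedGraph V E} (hc : G.IsCycle c) :
    G.IsInfinitePath (cyclePower c) := by
  intro k
  simp only [cyclePower, hc.closed]
  congr 2
  ext
  simp [Fin.val_add, Fin.ofNat]

variable (K : Type w) [Field K] [Fintype V]

/-- A cycle without exits in the Leavitt path algebra. -/
theorem IsCycle.cycleFamily {G : DirectedGraph V E} (hc : G.IsCycle c) (hex : ¬ G.HasExit c) :
    CycleFamily (fun i => G.vertex K (G.s (c i))) (fun i => G.edge K (c i))
      (fun i => G.ghost K (c i)) where
  idem _ := G.vertex_mul_self K _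
  orth _ _ h := G.vertex_mul_of_ne K fun h' => h (hc.source_injective h')
  source_edge _ := G.source_mul_edge K _
  edge_range _ := by rw [← hc.closed, edge_mul_range]
  range_ghost _ := by rw [← hc.closed, range_mul_ghost]
  ghost_source _ := G.ghost_mul_source K _
  edge_ghost i := by
    -- Without exits `c i` is the only edge leaving its source, so the sum in the second
    -- Cuntz–Krieger relation has one term.
    have hset : {e | G.s e = G.s (c i)} = {c i} := Set.ext fun e =>
      ⟨fun he => by_contra fun hne => hex ⟨e, i, he, hne⟩, fun he => congrArg G.s he⟩
    have hreg : G.IsRegular (G.s (c i)) := ⟨⟨c i, rfl⟩, by rw [hset]; exact Set.finite_singleton _⟩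
    have hfin : hreg.2.toFinset = {c i} := by
      ext e
      rw [Set.Finite.mem_toFinset, hset]
      simp
    rw [vertex_eq_sum _ _ _ hreg, hfin, Finset.sum_singleton]
  ghost_edge _ := by rw [ghost_mul_edge_self, hc.closed]

variable {K}

/-- The unit rotating a cycle acts on the path `c^∞` by a weight. -/
theorem IsCycle.exists_representation {G : DirectedGraph V E} (hc : G.IsCycle c)
    {U : (G.LeavittPathAlgebra K)ˣ}
    (hU : ∀ i, (U : G.LeavittPathAlgebra K) * G.vertex K (G.s (c (i + 1))) = G.edge K (c i))
    {t : K} (ht : t ≠ 0) :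
    ∃ (X : Type v) (ρ : G.LeavittPathAlgebra K →ₐ[K] Module.End K (X →₀ K)) (ξ : X →₀ K),
      ξ ≠ 0 ∧ ρ (G.vertex K (G.s (c 0))) ξ = ξ ∧ ρ ↑(U ^ n) ξ = t ^ n • ξ := by
  obtain ⟨ρ, hv, he, -⟩ := G.infinitePaths.exists_representation t ht
  -- `η k` is the tail of c^∞ from position k. The unit carries `η (k + 1)` to t times `η k`, and `η
  -- n` equals `η 0` by periodicity.
  let η : ℕ → {μ : ℕ → E // G.IsInfinitePath μ} := fun k =>
    ⟨fun m => cyclePower c (k + m), fun m => hc.isInfinitePath_cyclePower (k + m)⟩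
  have hvη (k) : ρ (G.vertex K (G.s (cyclePower c k))) (Finsupp.single (η k) 1) =
      Finsupp.single (η k) 1 := by
    rw [hv, PathSystem.vertexOp_single, if_pos]
    rfl
  have hUη (k) : ρ U (Finsupp.single (η (k + 1)) 1) = t • Finsupp.single (η k) 1 := by
    rw [← hvη (k + 1), ← hc.isInfinitePath_cyclePower k, ← Module.End.mul_apply, ← map_mul]
    simp only [cyclePower]
    rw [hc.closed, hU, he, PathSystem.edgeOp_single _
      (show G.infinitePaths.src (η (k + 1)) = G.r (c (Fin.ofNat n k)) from (hc.isInfinitePath_cyclePower k).symm)]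
    rw [one_mul, Finsupp.smul_single, smul_eq_mul, mul_one]
    congr 1
    refine Subtype.ext (funext fun m => ?_)
    cases m with
    | zero => rfl
    | succ m => exact congrArg (cyclePower c) (by omega)
  have hpow (k) : ρ ↑(U ^ k) (Finsupp.single (η k) 1) = t ^ k • Finsupp.single (η 0) 1 := by
    induction k with
    | zero => simp
    | succ k ih =>
      rw [pow_succ, Units.val_mul, map_mul, Module.End.mul_apply, hUη, map_smul, ih, smul_smul,
        pow_succ']
  refine ⟨_, ρ, Finsupp.single (η 0) 1, by simp, hvη 0, ?_⟩
  convert hpow n using 3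
  refine Subtype.ext (funext fun m => congrArg c ?_)
  ext
  simp [Fin.ofNat]

/-- The corner of a Leavitt path algebra at a vertex on a cycle without exits is spanned by the
powers of the rotation of the cycle. -/
theorem corner_mem_span {G : DirectedGraph V E} (hex : ¬ G.HasExit c)
    {U : (G.LeavittPathAlgebra K)ˣ}
    (hU : ∀ i, G.vertex K (G.s (c i)) * U = G.edge K (c i))
    (hU' : ∀ i, (U : G.LeavittPathAlgebra K) * G.vertex K (G.s (c (i + 1))) = G.edge K (c i))
    (hUg : ∀ i, (↑U⁻¹ : G.LeavittPathAlgebra K) * G.vertex K (G.s (c i)) = G.ghost K (c i))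
    (b : G.LeavittPathAlgebra K) :
    G.vertex K (G.s (c 0)) * b * G.vertex K (G.s (c 0)) ∈
      Submodule.span K (Set.range fun k : ℤ =>
        (↑(U ^ k) : G.LeavittPathAlgebra K) * G.vertex K (G.s (c 0))) := by
  set T := Submodule.span K (Set.range fun k : ℤ =>
    (↑(U ^ k) : G.LeavittPathAlgebra K) * G.vertex K (G.s (c 0)))
  have hmove (k : ℤ) (j : Fin n) :=
    CycleFamily.exists_zpow_mul (v := fun i => G.vertex K (G.s (c i)))
      (fun i => (hU i).trans (hU' i).symm) k j
  have mapT (a : G.LeavittPathAlgebra K)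
      (ha : ∀ k : ℤ, a * (↑(U ^ k) * G.vertex K (G.s (c 0))) ∈ T) : ∀ τ ∈ T, a * τ ∈ T := by
    have : T ≤ T.comap (LinearMap.mulLeft K a) :=
      Submodule.span_le.2 (by rintro _ ⟨k, rfl⟩; exact ha k)
    exact fun τ hτ => this hτ
  have U_T (l : ℤ) : ∀ τ ∈ T, ↑(U ^ l) * τ ∈ T := mapT _ fun k => by
    rw [← mul_assoc, ← Units.val_mul, ← zpow_add]
    exact Submodule.subset_span ⟨_, rfl⟩
  have vertex_T (x : V) : ∀ τ ∈ T, G.vertex K x * τ ∈ T := mapT _ fun k => by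
    obtain ⟨i, hi⟩ := hmove k 0
    by_cases hx : x = G.s (c i)
    · rw [hi, ← mul_assoc, hx, vertex_mul_self, ← hi]
      exact Submodule.subset_span ⟨_, rfl⟩
    · rw [hi, ← mul_assoc, vertex_mul_of_ne _ _ hx, zero_mul]
      exact T.zero_mem
  -- A ghost edge that does not kill a spanning vector starts on the cycle, hence belongs to it for
  -- lack of exits, and acts there as U⁻¹.
  have ghost_T (e : E) : ∀ τ ∈ T, G.ghost K e * τ ∈ T := mapT _ fun k => by
    obtain ⟨i, hi⟩ := hmove k 0
    by_cases he : G.s e = G.s (c i)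
    · obtain rfl : e = c i := by_contra fun hne => hex ⟨e, i, he, hne⟩
      rw [hi, ← mul_assoc, ghost_mul_source, ← hUg, mul_assoc, ← hi, ← zpow_neg_one]
      exact U_T _ _ (Submodule.subset_span ⟨_, rfl⟩)
    · rw [hi, ← mul_assoc, ghost_mul_vertex_of_ne _ he, zero_mul]
      exact T.zero_mem
  let N : Submonoid (G.LeavittPathAlgebra K) :=
    Submonoid.closure (Set.range (G.vertex K) ∪ Set.range (G.ghost K))
  have hNv (x) : G.vertex K x ∈ N := Submonoid.subset_closure (.inl ⟨x, rfl⟩)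
  have hNg (e) : G.ghost K e ∈ N := Submonoid.subset_closure (.inr ⟨e, rfl⟩)
  have N_T (x) (hx : x ∈ N) : ∀ τ ∈ T, x * τ ∈ T := by
    induction hx using Submonoid.closure_induction with
    | mem x hx =>
      obtain ⟨x, rfl⟩ | ⟨e, rfl⟩ := hx
      · exact vertex_T x
      · exact ghost_T e
    | one => simp
    | mul x y _ _ hx hy =>
      intro τ hτ
      rw [mul_assoc]
      exact hx _ (hy _ hτ)
  -- `T` need not be stable under edges that enter the cycle from outside. `Q` consists of the
  -- elements sent into `T` by every word in vertices and ghost edges followed by a cycle vertex on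
  -- the left, and is stable under all generators.
  let Q : Submodule K (G.LeavittPathAlgebra K) :=
    ⨅ x : N, ⨅ j : Fin n, T.comap (LinearMap.mulLeft K (G.vertex K (G.s (c j)) * x))
  have mem_Q (a) : a ∈ Q ↔ ∀ x ∈ N, ∀ j, G.vertex K (G.s (c j)) * x * a ∈ T := by
    simp [Q, Submodule.mem_iInf, mul_assoc]
  let S : Subalgebra K (G.LeavittPathAlgebra K) :=
    { carrier := {b | ∀ a ∈ Q, b * a ∈ Q}
      mul_mem' := fun hb hb' a ha => by
        rw [mul_assoc]
        exact hb _ (hb' _ ha)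
      add_mem' := fun hb hb' a ha => by
        rw [add_mul]
        exact Q.add_mem (hb _ ha) (hb' _ ha)
      algebraMap_mem' := fun r a ha => by
        rw [← Algebra.smul_def]
        exact Q.smul_mem r ha }
  have hS (b) : b ∈ S := by
    have hN (y) (hy : y ∈ N) : y ∈ S := fun a ha => (mem_Q _).2 fun x hx j => by
      rw [← mul_assoc, mul_assoc _ x y]
      exact (mem_Q a).1 ha _ (N.mul_mem hx hy) j
    refine G.mem_of_generators_mem S (fun x => hN _ (hNv x)) (fun e a ha => ?_)
      (fun e => hN _ (hNg e)) b
    rw [mem_Q] at ha ⊢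
    intro x hx
    -- The edge meets the last letter of the word: a vertex preserves or kills it, and a ghost edge
    -- cancels or kills it. If the word is empty, it meets a cycle vertex, so it is killed or is an
    -- edge of the cycle and acts as U.
    induction hx using Submonoid.closure_induction_right with
    | one =>
      intro j
      rw [mul_one]
      by_cases he : G.s (c j) = G.s e
      · obtain rfl : e = c j := by_contra fun hne => hex ⟨e, j, he.symm, hne⟩
        rw [← mul_assoc, source_mul_edge, ← hU', mul_assoc]
        simpa using U_T 1 _ (ha 1 N.one_mem (j + 1))
      · rw [← mul_assoc, vertex_mul_edge_of_ne _ he, zero_mul]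
        exact T.zero_mem
    | mul_right x hx y hy ih =>
      intro j
      rw [mul_assoc, mul_assoc, ← mul_assoc y]
      obtain ⟨y, rfl⟩ | ⟨f, rfl⟩ := hy
      · by_cases he : y = G.s e
        · rw [he, source_mul_edge, ← mul_assoc]
          exact ih j
        · rw [vertex_mul_edge_of_ne _ he, zero_mul, mul_zero, mul_zero]
          exact T.zero_mem
      · by_cases he : f = e
        · rw [he, ghost_mul_edge_self, ← mul_assoc x, ← mul_assoc]
          exact ha _ (N.mul_mem hx (hNv _)) j
        · rw [ghost_mul_edge_of_ne _ _ he, zero_mul, mul_zero, mul_zero]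
          exact T.zero_mem
  have h0 : G.vertex K (G.s (c 0)) ∈ Q := (mem_Q _).2 fun x hx j => by
    rw [mul_assoc]
    exact vertex_T _ _ (N_T _ hx _ (Submodule.subset_span ⟨0, by simp⟩))
  simpa [mul_assoc] using (mem_Q _).1 (hS b _ h0) 1 N.one_mem 0

/-- The Leavitt path algebra of a graph with a cycle without exits is not primitive. -/
theorem not_isPrimitiveRing_of_isCycle [CharZero K] {G : DirectedGraph V E} (hc : G.IsCycle c)
    (hex : ¬ G.HasExit c) : ¬ IsPrimitiveRing (G.LeavittPathAlgebra K) := by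
  intro hprim
  obtain ⟨U, hU, hU', hUg⟩ := (hc.cycleFamily K hex).exists_unit
  have hmove (k : ℤ) (j : Fin n) :=
    CycleFamily.exists_zpow_mul (v := fun i => G.vertex K (G.s (c i)))
      (fun i => (hU i).trans (hU' i).symm) k j
  set v := G.vertex K (G.s (c 0)) with hv
  have hvv : v * v = v := G.vertex_mul_self K _
  -- U^k carries v to some vertex of the cycle: either to v itself, and then they commute, or to an
  -- orthogonal one, and then the corner entry vanishes.
  have hpow (k : ℤ) : v * (↑(U ^ k) * v) * v = 0 ∨
      v * (↑(U ^ k) * v) * v = ↑(U ^ k) * v ∧ Commute (↑(U ^ k)) v := by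
    obtain ⟨i, hi⟩ := hmove k 0
    rw [← hv] at hi
    by_cases h0 : (0 : Fin n) = i
    · subst h0
      right
      refine ⟨?_, hi⟩
      rw [mul_assoc, mul_assoc, hvv, hi, ← mul_assoc, hvv]
    · left
      rw [hi, ← mul_assoc, (hc.cycleFamily K hex).orth 0 i h0, zero_mul, zero_mul]
  have hcommT : ∀ a b, Commute (v * a * v) (v * b * v) := by
    intro a b
    have corner (a) : v * (v * a * v) * v = v * a * v := by
      simp only [mul_assoc, hvv]
      simp only [← mul_assoc, hvv]
    have ha := corner_mem_span hex hU hU' hUg a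
    have hb := corner_mem_span hex hU hU' hUg b
    rw [← corner a, ← corner b]
    refine Submodule.span_induction₂
      (p := fun x y _ _ => Commute (v * x * v) (v * y * v)) ?_ ?_ ?_ ?_ ?_ ?_ ?_ ha hb
    · rintro _ _ ⟨k, rfl⟩ ⟨l, rfl⟩
      rcases hpow k with hk | ⟨hk, hk'⟩
      · exact hk ▸ Commute.zero_left _
      rcases hpow l with hl | ⟨hl, hl'⟩
      · exact hl ▸ Commute.zero_right _
      change Commute (v * (↑(U ^ k) * v) * v) (v * (↑(U ^ l) * v) * v)
      rw [hk, hl]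
      have hkl : Commute (↑(U ^ k) : G.LeavittPathAlgebra K) ↑(U ^ l) :=
        ((Commute.refl U).zpow_zpow k l).map (Units.coeHom _)
      exact (hkl.mul_right hk').mul_left (hl'.symm.mul_right (Commute.refl v))
    · simp
    · simp
    · intro x y z _ _ _ hx hy
      rw [mul_add, add_mul]
      exact hx.add_left hy
    · intro x y z _ _ _ hx hy
      rw [mul_add, add_mul]
      exact hx.add_right hy
    · intro r x y _ _ hx
      rw [mul_smul_comm, smul_mul_assoc]
      exact hx.smul_left r
    · intro r x y _ _ hx
      rw [mul_smul_comm, smul_mul_assoc]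
      exact hx.smul_right r
  -- This plays the role of 1 - x for x the cycle: nonzero, but vanishing under the evaluation x =
  -- 1.
  let z := v - v * ↑(U ^ n) * v
  have hz : v * z * v = z := by
    simp only [z, mul_sub, sub_mul, mul_assoc, hvv]
    simp only [← mul_assoc, hvv]
  have rep (t : K) (ht : t ≠ 0) :
      ∃ (X : Type _) (ρ : G.LeavittPathAlgebra K →ₐ[K] Module.End K (X →₀ K)) (ξ : X →₀ K),
        ξ ≠ 0 ∧ ρ v ξ = ξ ∧ ρ z ξ = (1 - t ^ n) • ξ := by
    obtain ⟨X, ρ, ξ, hξ, hvξ, hUξ⟩ := hc.exists_representation hU' ht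
    refine ⟨X, ρ, ξ, hξ, hvξ, ?_⟩
    simp only [z, map_sub, map_mul, LinearMap.sub_apply, Module.End.mul_apply, hv, hvξ, hUξ,
      map_smul, sub_smul, one_smul]
  have hz0 : z ≠ 0 := by
    obtain ⟨X, ρ, ξ, hξ, -, hzξ⟩ := rep 2 two_ne_zero
    intro h
    rw [h, map_zero, LinearMap.zero_apply, eq_comm, smul_eq_zero, or_iff_left hξ, sub_eq_zero] at hzξ
    have : 2 ^ n = 1 := by exact_mod_cast hzξ.symm
    exact NeZero.ne n (by simpa using this)
  obtain ⟨b, hb⟩ := hprim.exists_mul_eq_of_commute_corner hvv hcommT hz hz0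
  obtain ⟨X, ρ, ξ, hξ, hvξ, hzξ⟩ := rep 1 one_ne_zero
  apply hξ
  rw [← hvξ, ← hb, map_mul, Module.End.mul_apply, hzξ]
  simp

end DirectedGraph

/-! ### Admissible edges in graphs where no edge ends in a sink. -/

/-- A central idempotent of a primitive ring is trivial. -/
theorem IsPrimitiveRing.eq_zero_or_eq_one_of_isIdempotentElem {R : Type*} [Ring R]
    (hR : IsPrimitiveRing R) {x : R} (hx : IsIdempotentElem x) (hcomm : ∀ a, Commute x a) :
    x = 0 ∨ x = 1 := by
  obtain ⟨M, _, _, _, hann⟩ := hR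
  have faithful : ∀ r : R, (∀ m : M, r • m = 0) → r = 0 := fun r hr => by
    rw [← Submodule.mem_bot (R := R), ← hann]
    exact Module.mem_annihilator.2 hr
  -- Schur's lemma applies, since multiplication by a central element is an endomorphism of the
  -- simple module.
  let f : M →ₗ[R] M :=
    { toFun := fun m => x • m
      map_add' := smul_add x
      map_smul' := fun a m => by rw [← mul_smul, (hcomm a).eq, mul_smul, RingHom.id_apply] }
  rcases LinearMap.bijective_or_eq_zero f with hf | hf
  · right
    rw [← sub_eq_zero]
    refine faithful _ fun m => hf.1 ?_
    change x • (x - 1) • m = x • 0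
    rw [← mul_smul, mul_sub, hx.eq, mul_one, sub_self, zero_smul, smul_zero]
  · exact .inl (faithful x fun m => LinearMap.congr_fun hf m)

namespace DirectedGraph

universe u v w

variable {V : Type u} {E : Type v} (G : DirectedGraph V E) (K : Type w) [Field K]

theorem exists_isInfinitePath (h : ∀ e, ¬ G.IsSink (G.r e)) (f : E) :
    ∃ μ, G.IsInfinitePath μ ∧ μ 0 = f := by
  simp only [IsSink, not_forall, not_not] at h
  choose next hnext using h
  exact ⟨fun k => next^[k] f, fun k => by
    simp only [Function.iterate_succ_apply', hnext], rfl⟩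

variable [Fintype V]

/-- If the Leavitt path algebra is primitive and no edge ends in a sink, all edges are
admissible. -/
theorem isAdmissibleEdge_of_isPrimitiveRing [CharZero K]
    (hprim : IsPrimitiveRing (G.LeavittPathAlgebra K)) (h : ∀ e, ¬ G.IsSink (G.r e)) (f : E) :
    G.IsAdmissibleEdge f := by
  obtain ⟨μ, hμ, h0⟩ := G.exists_isInfinitePath h f
  refine .inl ⟨μ, hμ, h0, ?_⟩
  rintro ⟨n, _, c, hc, hex, -⟩
  exact not_isPrimitiveRing_of_isCycle hc hex hprim

theorem commute_of_isEmpty [IsEmpty E] (a b : G.LeavittPathAlgebra K) : Commute a b := by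
  refine G.commute_of_commute_generators (fun x => ?_) isEmptyElim isEmptyElim b
  refine (G.commute_of_commute_generators (fun y => ?_) isEmptyElim isEmptyElim a).symm
  by_cases h : x = y
  · rw [h]
  · rw [Commute, SemiconjBy, vertex_mul_of_ne _ _ h, vertex_mul_of_ne _ _ (Ne.symm h)]

/-- If all edges are loops, then the vertices are central. -/
theorem commute_vertex_of_source_eq_range (h : ∀ e, G.s e = G.r e) (x : V)
    (a : G.LeavittPathAlgebra K) : Commute (G.vertex K x) a := by
  refine G.commute_of_commute_generators (fun y => ?_) (fun e => ?_) (fun e => ?_) a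
  · by_cases hxy : x = y
    · rw [hxy]
    · rw [Commute, SemiconjBy, vertex_mul_of_ne _ _ hxy, vertex_mul_of_ne _ _ (Ne.symm hxy)]
  · rw [Commute, SemiconjBy]
    by_cases hx : x = G.s e
    · rw [hx, source_mul_edge, h, edge_mul_range]
    · rw [vertex_mul_edge_of_ne _ hx, edge_mul_vertex_of_ne _ (h e ▸ Ne.symm hx)]
  · rw [Commute, SemiconjBy]
    by_cases hx : x = G.s e
    · rw [hx, ghost_mul_source, h, range_mul_ghost]
    · rw [ghost_mul_vertex_of_ne _ (Ne.symm hx), vertex_mul_ghost_of_ne _ (h e ▸ hx)]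

/-- Every vertex is a sink or starts an infinite path, so one of the two path representations
detects it. -/
theorem vertex_ne_zero_of_forall_not_isSink (h : ∀ e, ¬ G.IsSink (G.r e)) (x : V) :
    G.vertex K x ≠ 0 := by
  by_cases hx : G.IsSink x
  · exact G.vertex_ne_zero_of_isSink K hx
  · simp only [IsSink, not_forall, not_not] at hx
    obtain ⟨e, rfl⟩ := hx
    obtain ⟨μ, hμ, rfl⟩ := G.exists_isInfinitePath h e
    exact G.source_ne_zero_of_isInfinitePath K hμ

theorem exists_source_ne_range [Nontrivial V]
    (hprim : IsPrimitiveRing (G.LeavittPathAlgebra K)) (h : ∀ e, ¬ G.IsSink (G.r e)) :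
    ∃ f, G.s f ≠ G.r f := by
  by_contra! hloop
  have hone (x) : G.vertex K x = 1 :=
    (hprim.eq_zero_or_eq_one_of_isIdempotentElem (G.vertex_mul_self K x)
      (G.commute_vertex_of_source_eq_range K hloop x)).resolve_left
      (G.vertex_ne_zero_of_forall_not_isSink K h x)
  obtain ⟨x, y, hxy⟩ := exists_pair_ne V
  apply G.vertex_ne_zero_of_forall_not_isSink K h y
  rw [← one_mul (G.vertex K y), ← hone x, vertex_mul_of_ne _ _ hxy]

end DirectedGraph

/-! ### The main theorem. -/

theorem mainTheorem6 {V E : Type*} [Fintype V] (G : DirectedGraph V E)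
    (K : Type*) [Field K] [CharZero K]
    (hprim : IsPrimitiveRing (G.LeavittPathAlgebra K))
    (hnc : ∃ x y : G.LeavittPathAlgebra K, x * y ≠ y * x) :
    (∃ f : E, G.IsAdmissibleEdge f) ∧
    (Nontrivial V →
      ∃ f : E, G.IsAdmissibleEdge f ∧ G.GeneratesNonCyclicFreeSubgroup K f) ∧
    (∀ f : E, G.IsAdmissibleEdge f → G.s f ≠ G.r f →
      G.GeneratesNonCyclicFreeSubgroup K f) := by
  have free : ∀ f : E, G.IsAdmissibleEdge f → G.s f ≠ G.r f →
      G.GeneratesNonCyclicFreeSubgroup K f := fun f hf hsr =>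
    G.generatesNonCyclicFreeSubgroup_of_source_ne_range K hsr (hf.range_ne_zero _ K)
  refine ⟨?_, fun _ => ?_, free⟩
  · have : Nonempty E := by
      by_contra hE
      rw [not_nonempty_iff] at hE
      obtain ⟨x, y, hxy⟩ := hnc
      exact hxy (G.commute_of_isEmpty K x y)
    by_cases h : ∃ e, G.IsSink (G.r e)
    · exact h.imp fun e he => .inr he
    · push Not at h
      exact ⟨_, G.isAdmissibleEdge_of_isPrimitiveRing K hprim h (Classical.arbitrary E)⟩
  · by_cases h : ∃ e, G.IsSink (G.r e)
    · obtain ⟨f, hf⟩ := h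
      -- `hf f` says that the sink r(f) is not the source of f, so f is not a loop.
      exact ⟨f, .inr hf, free f (.inr hf) (hf f)⟩
    · push Not at h
      obtain ⟨f, hf⟩ := G.exists_source_ne_range K hprim h
      have hadm := G.isAdmissibleEdge_of_isPrimitiveRing K hprim h f
      exact ⟨f, hadm, free f hadm hf⟩
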